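/- For $m=10^6$ and a probability distribution on $\mathbb{R}$ with distribution function $F$, let $F_m$ be the empirical distribution function of $m$ independent observations from $F$, let $$D_m=\sup_{x\in\mathbb{R}}|F_m(x)-F(x)|,\qquad T_m=\int_0^1|F_m^{-1}(u)-F^{-1}(u)|^2\,du,$$ where $H^{-1}(u)=\inf\{x: H(x)\ge u\}$ denotes the quantile function of a distribution function $H$, and let $\mathrm{med}_F(D_m)$ and $\mathrm{med}_F(T_m)$ be the medians of these two statistics (the median of $T$ being the least $t$ with $P(T\le t)\ge 1/2$). A distribution function $G$ is called *empirically indistinguishable* from $F$ if, for $m=10^6$, $$\sup_{x\in\mathbb{R}}|G(x)-F(x)|\le \mathrm{med}_F(D_m)\qquad\text{and}\qquad \int_0^1|G^{-1}(u)-F^{-1}(u)|^2\,du\le \mathrm{med}_F(T_m).$$ **Proposition.** For each $n\ge 2$ there exist an $n$-dimensional copula $C$ and a value of $\sigma^2>0$ such that, if $X_1,\dots,X_n$ are random variables with distribution $\mathcal{N}(0,\sigma^2)$ each and with copula $C$, then the distribution of $X_1+\dots+X_n$ is empirically indistinguishable from the uniform distribution $\mathcal{U}[-1,1]$. (Such $X_1,\dots,X_n$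 exist for this $C$ and $\sigma^2$.) -/

import Mathlib

open MeasureTheory ProbabilityTheory
open scoped NNReal ENNReal

noncomputable section

/-- The uniform distribution on the interval `[a, b]`. -/
def uniformLaw (a b : ℝ) : Measure ℝ := volume[|Set.Icc a b]

/-- The function `C` is an `n`-dimensional copula: on `[0,1]^n` it is the joint distribution
function of a random vector whose coordinates are all uniform on `[0, 1]`.
(The values of `C` outside `[0,1]^n` play no role.) -/
def IsCopula {n : ℕ} (C : (Fin n → ℝ) → ℝ) : Prop :=
  ∃ ν : Measure (Fin n → ℝ), IsProbabilityMeasure ν ∧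
    (∀ i, ν.map (fun x => x i) = uniformLaw 0 1) ∧
    ∀ u ∈ Set.Icc (0 : Fin n → ℝ) 1, C u = ν.real {x | ∀ i, x i ≤ u i}

/-- `μ` is the joint law of `n` random variables, each with law `ρ`, whose copula is `C`, that is,
`P(X₁ ≤ x₁, …, Xₙ ≤ xₙ) = C(F(x₁), …, F(xₙ))` with `F` the distribution function of `ρ`. -/
structure IsJointLaw {n : ℕ} (μ : Measure (Fin n → ℝ)) (ρ : Measure ℝ)
    (C : (Fin n → ℝ) → ℝ) : Prop where
  isProbabilityMeasure : IsProbabilityMeasure μ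
  marginal : ∀ i, μ.map (fun x => x i) = ρ
  copula : ∀ x : Fin n → ℝ, μ.real {y | ∀ i, y i ≤ x i} = C (fun i => cdf ρ (x i))

/-- The quantile function `F⁻¹(u) = inf {x | u ≤ F(x)}`, to be used for `0 < u < 1`. -/
def quantile (F : ℝ → ℝ) (u : ℝ) : ℝ := sInf {x | u ≤ F x}

/-- The empirical distribution function of the sample `x₁, …, xₘ`. -/
def empiricalCDF {m : ℕ} (x : Fin m → ℝ) (t : ℝ) : ℝ :=
  ((Finset.univ.filter fun i => x i ≤ t).card : ℝ) / m

/-- The Kolmogorov-Smirnov distance `sup_x |G(x) - F(x)|`. -/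
def ksDist (G F : ℝ → ℝ) : ℝ≥0∞ := ⨆ x : ℝ, ENNReal.ofReal |G x - F x|

/-- The squared `L²`-Wasserstein distance `∫₀¹ |G⁻¹(u) - F⁻¹(u)|² du`. -/
def wassersteinSq (G F : ℝ → ℝ) : ℝ≥0∞ :=
  ∫⁻ u in Set.Ioo (0 : ℝ) 1, ENNReal.ofReal (|quantile G u - quantile F u| ^ 2)

/-- The median `inf {t | P(T ≤ t) ≥ 1/2}` of a nonnegative statistic `T`. -/
def median {Ω : Type*} [MeasurableSpace Ω] (P : Measure Ω) (T : Ω → ℝ≥0∞) : ℝ≥0∞ :=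
  sInf {t | 1 / 2 ≤ P {ω | T ω ≤ t}}

/-- The law of a sample of `m` independent observations from `ρ`. -/
def sampleLaw (m : ℕ) (ρ : Measure ℝ) : Measure (Fin m → ℝ) := Measure.pi fun _ => ρ

/-- The median of `D_m = sup_x |F_m(x) - F(x)|`, with `F_m` the empirical distribution function of
`m` independent observations from the law `ρ`, whose distribution function is `F`. -/
def medKS (m : ℕ) (ρ : Measure ℝ) : ℝ≥0∞ :=
  median (sampleLaw m ρ) fun x => ksDist (empiricalCDF x) (cdf ρ)

/-- The median of `T_m = ∫₀¹ |F_m⁻¹(u) - F⁻¹(u)|² du`, for the same `F_m` and `F`. -/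
def medWasserstein (m : ℕ) (ρ : Measure ℝ) : ℝ≥0∞ :=
  median (sampleLaw m ρ) fun x => wassersteinSq (empiricalCDF x) (cdf ρ)

/-- The law `γ` (with distribution function `G`) is empirically Kolmogorov-Smirnov
indistinguishable from the law `ρ` (with distribution function `F`) at sample size `m`. -/
def KSIndistinguishable (m : ℕ) (γ ρ : Measure ℝ) : Prop :=
  ksDist (cdf γ) (cdf ρ) ≤ medKS m ρ

/-- The law `γ` is empirically `L²`-Wasserstein indistinguishable from the law `ρ`
at sample size `m`. -/
def WassersteinIndistinguishable (m : ℕ) (γ ρ : Measure ℝ) : Prop :=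
  wassersteinSq (cdf γ) (cdf ρ) ≤ medWasserstein m ρ

/-- Empirical indistinguishability, at the sample size `m = 10⁶`. -/
def EmpiricallyIndistinguishable (γ ρ : Measure ℝ) : Prop :=
  WassersteinIndistinguishable (10 ^ 6) γ ρ ∧ KSIndistinguishable (10 ^ 6) γ ρ

end

/-!
The two medians are positive for a deterministic reason: an empirical distribution function of `m`
observations jumps by at least `1/m`, and its quantile function is constant on `(0, 1/m)`, so its
distances to `𝒰[-1,1]` are bounded below for every sample (`le_ksDist_empiricalCDF`,
`le_wassersteinSq_empiricalCDF`). Hence it suffices to make the sum arbitrarily close to `𝒰[-1,1]`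
in the Kolmogorov-Smirnov distance while keeping it in `[-2, 2]`; closeness in the Wasserstein
distance follows (`wassersteinSq_uniformLaw_le`).

Such sums exist because a Gaussian law of large variance is locally almost flat, so that adding an
independent uniform variable almost preserves it. After rescaling, let `Z ∼ 𝒩(0,1)` and
`U ∼ 𝒰[-1,1]` be independent and let `T_ε` be the monotone map transporting the law of `Z + ε U` to
`𝒩(0,1)`. Then `X = T_ε(Z + ε U)` and `Z` are both standard Gaussian. Since `U` is centred, the
distribution function of `Z + ε U` agrees with that of `Z` to first order in `ε`
(`hasDerivAt_cdf_perturbedGaussian`), whence `(X - Z) / ε → U` pointwise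
(`tendsto_transport_sub_div`), and `|X - Z| ≤ 2ε` (`transport_sub_div_mem_Icc`). Thus `X / ε` and
`-Z / ε` are Gaussian with variance `ε⁻²` and their sum is almost uniform
(`exists_gaussian_coupling`). For `n > 2` further Gaussian variables are added that do not change
the sum (`exists_gaussian_vector_sum_eq`). Finally, the Gaussian marginals and the copula determine
the joint law (`IsJointLaw.unique`), so the conclusion holds for every vector with this copula.
-/

open Filter Topology

/-! ### The uniform law -/

lemma isProbabilityMeasure_uniformLaw {a b : ℝ} (hab : a < b) :
    IsProbabilityMeasure (uniformLaw a b) :=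
  cond_isProbabilityMeasure_of_finite (by simpa using hab) (by simp)

lemma uniformLaw_real_Iic {a b x : ℝ} (hab : a < b) (hx : x ∈ Set.Icc a b) :
    (uniformLaw a b).real (Set.Iic x) = (x - a) / (b - a) := by
  have : Set.Icc a b ∩ Set.Iic x = Set.Icc a x := by
    ext y
    simp only [Set.mem_inter_iff, Set.mem_Icc, Set.mem_Iic]
    exact ⟨fun h => ⟨h.1.1, h.2⟩, fun h => ⟨⟨h.1, h.2.trans hx.2⟩, h.2⟩⟩
  rw [uniformLaw, measureReal_def, cond_apply measurableSet_Icc, this, ENNReal.toReal_mul,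
    ENNReal.toReal_inv, ← measureReal_def, ← measureReal_def, Real.volume_real_Icc_of_le hab.le,
    Real.volume_real_Icc_of_le hx.1, div_eq_inv_mul]

lemma uniformLaw_compl_Icc (a b : ℝ) : uniformLaw a b (Set.Icc a b)ᶜ = 0 := by
  rw [uniformLaw, cond_apply measurableSet_Icc]
  simp

lemma cdf_uniformLaw {a b x : ℝ} (hab : a < b) (hx : x ∈ Set.Icc a b) :
    cdf (uniformLaw a b) x = (x - a) / (b - a) := by
  have := isProbabilityMeasure_uniformLaw hab
  rw [cdf_eq_real, uniformLaw_real_Iic hab hx]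

lemma cdf_eq_zero_of_compl_Icc {μ : Measure ℝ} [IsProbabilityMeasure μ] {a b x : ℝ}
    (h : μ (Set.Icc a b)ᶜ = 0) (hx : x < a) : cdf μ x = 0 := by
  rw [cdf_eq_real, measureReal_eq_zero_iff]
  exact measure_mono_null
    (show Set.Iic x ⊆ (Set.Icc a b)ᶜ from fun y hy hy' => (hx.trans_le hy'.1).not_ge hy) h

lemma cdf_eq_one_of_compl_Icc {μ : Measure ℝ} [IsProbabilityMeasure μ] {a b x : ℝ}
    (h : μ (Set.Icc a b)ᶜ = 0) (hx : b ≤ x) : cdf μ x = 1 := by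
  have : μ (Set.Iic x) = 1 := (prob_compl_eq_zero_iff measurableSet_Iic).1 (measure_mono_null
    (Set.compl_subset_compl.2 fun y hy => hy.2.trans hx) h)
  rw [cdf_eq_real, measureReal_def, this, ENNReal.toReal_one]

/-- The distribution function of `𝒰[-1,1]` is `1/2`-Lipschitz. -/
lemma cdf_uniformLaw_add_le (x : ℝ) {h : ℝ} (hh : 0 ≤ h) :
    cdf (uniformLaw (-1) 1) (x + h) ≤ cdf (uniformLaw (-1) 1) x + h / 2 := by
  have hp := isProbabilityMeasure_uniformLaw (show (-1 : ℝ) < 1 by norm_num)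
  have hc := fun y hy => cdf_uniformLaw (x := y) (show (-1 : ℝ) < 1 by norm_num) hy
  have h0 := cdf_nonneg (uniformLaw (-1) 1) x
  have h1 := cdf_le_one (uniformLaw (-1) 1) (x + h)
  rcases lt_or_ge (x + h) (-1) with hx | hx
  · rw [cdf_eq_zero_of_compl_Icc (uniformLaw_compl_Icc _ _) hx]; linarith
  rcases lt_or_ge 1 x with hx' | hx'
  · rw [cdf_eq_one_of_compl_Icc (x := x) (uniformLaw_compl_Icc _ _) hx'.le]; linarith
  have hu : cdf (uniformLaw (-1) 1) (x + h) ≤ (x + h + 1) / 2 := by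
    rcases le_or_gt (x + h) 1 with h2 | h2
    · rw [hc _ ⟨hx, h2⟩]; norm_num
    · linarith
  have hl : (x + 1) / 2 ≤ cdf (uniformLaw (-1) 1) x := by
    rcases le_or_gt (-1) x with h2 | h2
    · rw [hc _ ⟨h2, hx'⟩]; norm_num
    · linarith
  linarith

/-! ### Quantile functions -/

lemma quantile_eq_of_forall_le_iff {F : ℝ → ℝ} {u a : ℝ} (h : ∀ x, u ≤ F x ↔ a ≤ x) :
    quantile F u = a := by
  simp only [quantile, h]
  exact csInf_Ici

lemma quantile_mem_Icc {F : ℝ → ℝ} {u a b : ℝ} (ha : ∀ x < a, F x < u) (hb : u ≤ F b) :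
    quantile F u ∈ Set.Icc a b := by
  have hl : a ∈ lowerBounds {x | u ≤ F x} := fun x hx => not_lt.1 fun h => (ha x h).not_ge hx
  exact ⟨le_csInf ⟨b, hb⟩ hl, csInf_le ⟨a, hl⟩ hb⟩

lemma quantile_uniformLaw {u : ℝ} (hu : u ∈ Set.Ioo (0 : ℝ) 1) :
    quantile (cdf (uniformLaw (-1) 1)) u = 2 * u - 1 := by
  have hp := isProbabilityMeasure_uniformLaw (show (-1 : ℝ) < 1 by norm_num)
  refine quantile_eq_of_forall_le_iff fun x => ?_
  rcases lt_or_ge x (-1) with hx | hx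
  · rw [cdf_eq_zero_of_compl_Icc (uniformLaw_compl_Icc _ _) hx]
    constructor <;> intro h <;> linarith [hu.1, hu.2]
  rcases lt_or_ge 1 x with hx' | hx'
  · rw [cdf_eq_one_of_compl_Icc (uniformLaw_compl_Icc _ _) hx'.le]
    constructor <;> intro h <;> linarith [hu.1, hu.2]
  rw [cdf_uniformLaw (by norm_num) ⟨hx, hx'⟩]
  constructor <;> intro h <;> linarith

/-! ### Upper bounds for the distances to the uniform law -/

lemma ksDist_le {G F : ℝ → ℝ} {δ : ℝ} (h : ∀ x, |G x - F x| ≤ δ) :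
    ksDist G F ≤ ENNReal.ofReal δ :=
  iSup_le fun x => ENNReal.ofReal_le_ofReal (h x)

/-- For laws on a fixed bounded interval the Wasserstein distance to `𝒰[-1,1]` is controlled by
the Kolmogorov-Smirnov distance: away from levels within `δ` of `0` and `1` the quantile functions
differ by at most `2δ`, and at those remaining levels by at most `3`. -/
lemma wassersteinSq_uniformLaw_le {γ : Measure ℝ} [IsProbabilityMeasure γ] {δ : ℝ} (hδ : 0 < δ)
    (hsupp : γ (Set.Icc (-2) 2)ᶜ = 0)
    (h : ∀ x, |cdf γ x - cdf (uniformLaw (-1) 1) x| ≤ δ) :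
    wassersteinSq (cdf γ) (cdf (uniformLaw (-1) 1)) ≤ ENNReal.ofReal (4 * δ ^ 2 + 18 * δ) := by
  have hp := isProbabilityMeasure_uniformLaw (show (-1 : ℝ) < 1 by norm_num)
  have hc := fun y hy => cdf_uniformLaw (x := y) (show (-1 : ℝ) < 1 by norm_num) hy
  set E : Set ℝ := Set.Ioc 0 δ ∪ Set.Ico (1 - δ) 1
  have hE : MeasurableSet E := measurableSet_Ioc.union measurableSet_Ico
  have key : ∀ u ∈ Set.Ioo (0 : ℝ) 1,
      ENNReal.ofReal (|quantile (cdf γ) u - quantile (cdf (uniformLaw (-1) 1)) u| ^ 2) ≤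
        ENNReal.ofReal (4 * δ ^ 2) + E.indicator (fun _ => 9) u := by
    intro u hu
    rw [quantile_uniformLaw hu]
    by_cases hE : u ∈ E
    · rw [Set.indicator_of_mem hE]
      have h2 : quantile (cdf γ) u ∈ Set.Icc (-2 : ℝ) 2 := by
        refine quantile_mem_Icc (fun x hx => ?_) ?_
        · rw [cdf_eq_zero_of_compl_Icc hsupp hx]; exact hu.1
        · rw [cdf_eq_one_of_compl_Icc hsupp le_rfl]; exact hu.2.le
      have h3 : |quantile (cdf γ) u - (2 * u - 1)| ≤ 3 := by
        rw [abs_le]; constructor <;> linarith [hu.1, hu.2, h2.1, h2.2]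
      refine le_add_left (ENNReal.ofReal_le_of_le_toReal ?_)
      have := abs_nonneg (quantile (cdf γ) u - (2 * u - 1))
      norm_num
      nlinarith [sq_abs (quantile (cdf γ) u - (2 * u - 1))]
    · rw [Set.indicator_of_notMem hE, add_zero]
      have h1 : δ < u := by
        by_contra! h'; exact hE (Or.inl ⟨hu.1, h'⟩)
      have h1' : u < 1 - δ := by
        by_contra! h'; exact hE (Or.inr ⟨h', hu.2⟩)
      have h2 : quantile (cdf γ) u ∈ Set.Icc (2 * (u - δ) - 1) (2 * (u + δ) - 1) := by
        refine quantile_mem_Icc (fun x hx => ?_) ?_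
        · refine (monotone_cdf γ (le_max_left x (-1))).trans_lt ?_
          have := (abs_le.1 (h (max x (-1)))).2
          rw [hc _ ⟨le_max_right _ _, max_le (by linarith) (by norm_num)⟩] at this
          have h3 : max x (-1) < 2 * (u - δ) - 1 := max_lt hx (by linarith)
          linarith
        · have := (abs_le.1 (h (2 * (u + δ) - 1))).1
          rw [hc _ ⟨by linarith, by linarith⟩] at this
          linarith
      have h3 : |quantile (cdf γ) u - (2 * u - 1)| ≤ 2 * δ := by
        rw [abs_le]; constructor <;> linarith [h2.1, h2.2]
      refine ENNReal.ofReal_le_ofReal ?_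
      have := abs_nonneg (quantile (cdf γ) u - (2 * u - 1))
      nlinarith
  calc wassersteinSq (cdf γ) (cdf (uniformLaw (-1) 1))
      ≤ ∫⁻ u in Set.Ioo (0 : ℝ) 1, (ENNReal.ofReal (4 * δ ^ 2) + E.indicator (fun _ => 9) u) :=
        setLIntegral_mono' measurableSet_Ioo key
    _ = ENNReal.ofReal (4 * δ ^ 2) + ∫⁻ u in Set.Ioo (0 : ℝ) 1, E.indicator (fun _ => 9) u := by
        rw [lintegral_add_left measurable_const]; simp
    _ ≤ ENNReal.ofReal (4 * δ ^ 2) + ∫⁻ u, E.indicator (fun _ => 9) u := by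
        gcongr; exact Measure.restrict_le_self
    _ ≤ ENNReal.ofReal (4 * δ ^ 2) + 9 * (ENNReal.ofReal δ + ENNReal.ofReal δ) := by
        rw [lintegral_indicator_const hE]
        gcongr
        refine (measure_union_le _ _).trans_eq ?_
        simp
    _ = ENNReal.ofReal (4 * δ ^ 2 + 18 * δ) := by
        rw [ENNReal.ofReal_add (by positivity) (by positivity), ← ENNReal.ofReal_add hδ.le hδ.le,
          show (9 : ℝ≥0∞) = ENNReal.ofReal 9 by norm_num, ← ENNReal.ofReal_mul (by norm_num)]
        ring_nf

/-! ### Lower bounds for the medians -/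

lemma le_median {Ω : Type*} [MeasurableSpace Ω] {P : Measure Ω} {T : Ω → ℝ≥0∞} {c : ℝ≥0∞}
    (h : ∀ ω, c ≤ T ω) : c ≤ median P T := by
  refine le_sInf fun t ht => ?_
  by_contra! hlt
  have : {ω | T ω ≤ t} = ∅ := Set.eq_empty_of_forall_notMem fun ω hω =>
    ((h ω).trans hω).not_gt hlt
  simp [this] at ht

/-- An empirical distribution function has a jump of height at least `1/m`, whereas that of
`𝒰[-1,1]` is Lipschitz, so one of the two sides of the jump is far off. -/
lemma le_ksDist_empiricalCDF {m : ℕ} (hm : 0 < m) (x : Fin m → ℝ) :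
    ENNReal.ofReal (1 / (4 * m)) ≤ ksDist (empiricalCDF x) (cdf (uniformLaw (-1) 1)) := by
  have hm' : (0 : ℝ) < m := by exact_mod_cast hm
  set t := x ⟨0, hm⟩
  set s := t - 1 / m
  have hst : s < t := by simp only [s]; linarith [show (0 : ℝ) < 1 / m by positivity]
  have hjump : empiricalCDF x s + 1 / m ≤ empiricalCDF x t := by
    rw [empiricalCDF, empiricalCDF, ← add_div]
    gcongr
    have : (Finset.univ.filter fun i => x i ≤ s) ⊂ Finset.univ.filter fun i => x i ≤ t := by
      refine (Finset.ssubset_iff_of_subset fun i hi => ?_).2 ⟨⟨0, hm⟩, ?_, ?_⟩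
      · simp only [Finset.mem_filter_univ] at hi ⊢
        exact hi.trans hst.le
      · simp [t]
      · simpa using hst
    exact_mod_cast Finset.card_lt_card this
  have hlip := cdf_uniformLaw_add_le s (h := 1 / m) (by positivity)
  rw [show s + 1 / m = t by simp [s]] at hlip
  have h4 : (1 : ℝ) / (4 * m) = 1 / m / 4 := by field_simp
  rcases le_or_gt (1 / (4 * m) : ℝ) |empiricalCDF x t - cdf (uniformLaw (-1) 1) t| with h | h
  · exact (ENNReal.ofReal_le_ofReal h).trans (le_iSup_of_le t le_rfl)
  · refine (ENNReal.ofReal_le_ofReal ?_).trans (le_iSup_of_le s le_rfl)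
    refine le_trans ?_ (neg_le_abs _)
    have := (abs_lt.1 h).2
    linarith [show (0 : ℝ) < 1 / m by positivity]

/-- The empirical quantile function is constant at levels below `1/m`. -/
lemma quantile_empiricalCDF_eq {m : ℕ} (x : Fin m → ℝ) {u v : ℝ}
    (hu : u ∈ Set.Ioo (0 : ℝ) (1 / m)) (hv : v ∈ Set.Ioo (0 : ℝ) (1 / m)) :
    quantile (empiricalCDF x) u = quantile (empiricalCDF x) v := by
  have key : ∀ w ∈ Set.Ioo (0 : ℝ) (1 / m), ∀ y, w ≤ empiricalCDF x y ↔ ∃ i, x i ≤ y := by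
    intro w hw y
    constructor
    · intro h
      by_contra! h'
      have : (Finset.univ.filter fun i => x i ≤ y) = ∅ := by
        simpa [Finset.filter_eq_empty_iff] using h'
      simp only [empiricalCDF, this, Finset.card_empty, Nat.cast_zero, zero_div] at h
      exact hw.1.not_ge h
    · rintro ⟨i, hi⟩
      refine hw.2.le.trans ?_
      rw [empiricalCDF]
      gcongr
      exact_mod_cast Finset.card_pos.2 ⟨i, by simpa using hi⟩
  simp only [quantile, key u hu, key v hv]

/-- At levels below `1/m` the empirical quantile function is a constant `a`, so on the first or on
the last quarter of `(0, 1/m)` it differs from `2u - 1` by at least `1/(2m)`. -/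
lemma le_wassersteinSq_empiricalCDF {m : ℕ} (hm : 0 < m) (x : Fin m → ℝ) :
    ENNReal.ofReal (1 / (4 * m) * (1 / (2 * m)) ^ 2) ≤
      wassersteinSq (empiricalCDF x) (cdf (uniformLaw (-1) 1)) := by
  have hm' : (1 : ℝ) ≤ m := by exact_mod_cast hm
  have hm0 : (0 : ℝ) < 1 / m := by positivity
  have hm1 : (1 : ℝ) / m ≤ 1 := by rw [div_le_one (by positivity)]; exact hm'
  have h4 : (1 : ℝ) / (4 * m) = 1 / m / 4 := by field_simp
  have h2 : (1 : ℝ) / (2 * m) = 1 / m / 2 := by field_simp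
  rw [h4, h2]
  generalize hr : (1 : ℝ) / m = r at *
  set a := quantile (empiricalCDF x) (r / 2)
  have ha : ∀ u ∈ Set.Ioo 0 r, quantile (empiricalCDF x) u = a := fun u hu =>
    quantile_empiricalCDF_eq x (by rwa [hr]) (by rw [hr]; exact ⟨by linarith, by linarith⟩)
  have bound : ∀ b c : ℝ, 0 ≤ b → c ≤ r → c - b = r / 4 →
      (∀ u ∈ Set.Ioo b c, r / 2 ≤ |a - (2 * u - 1)|) →
      ENNReal.ofReal (r / 4 * (r / 2) ^ 2) ≤
        wassersteinSq (empiricalCDF x) (cdf (uniformLaw (-1) 1)) := by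
    intro b c hb hcr hbc h
    calc ENNReal.ofReal (r / 4 * (r / 2) ^ 2)
        = ∫⁻ u in Set.Ioo b c, ENNReal.ofReal ((r / 2) ^ 2) := by
          rw [setLIntegral_const, Real.volume_Ioo, hbc, mul_comm, ENNReal.ofReal_mul (by positivity)]
      _ ≤ ∫⁻ u in Set.Ioo b c, ENNReal.ofReal
            (|quantile (empiricalCDF x) u - quantile (cdf (uniformLaw (-1) 1)) u| ^ 2) := by
          refine setLIntegral_mono' measurableSet_Ioo fun u hu => ENNReal.ofReal_le_ofReal ?_
          rw [ha u ⟨hb.trans_lt hu.1, hu.2.trans_le hcr⟩,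
            quantile_uniformLaw ⟨hb.trans_lt hu.1, (hu.2.trans_le hcr).trans_le hm1⟩]
          have := h u hu
          gcongr
      _ ≤ _ := lintegral_mono_set (Set.Ioo_subset_Ioo hb (hcr.trans hm1))
  rcases le_total r (a + 1) with h | h
  · refine bound 0 (r / 4) le_rfl (by linarith) (by ring) fun u hu => le_abs.2 (Or.inl ?_)
    linarith [hu.2]
  · refine bound (3 * r / 4) r (by linarith) le_rfl (by ring) fun u hu => le_abs.2 (Or.inr ?_)
    linarith [hu.1]

/-- The medians of `Dₘ` and `Tₘ` being positive, every law supported in `[-2,2]` whose distribution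
function is uniformly close enough to that of `𝒰[-1,1]` is empirically indistinguishable
from it. -/
lemma exists_forall_empiricallyIndistinguishable :
    ∃ δ > 0, ∀ γ : Measure ℝ, IsProbabilityMeasure γ → γ (Set.Icc (-2) 2)ᶜ = 0 →
      (∀ x, |cdf γ x - cdf (uniformLaw (-1) 1) x| ≤ δ) →
      EmpiricallyIndistinguishable γ (uniformLaw (-1) 1) := by
  have hm : 0 < 10 ^ 6 := by norm_num
  set m : ℕ := 10 ^ 6
  have hm' : (1 : ℝ) ≤ m := by exact_mod_cast hm
  set c : ℝ := 1 / (4 * m) * (1 / (2 * m)) ^ 2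
  have hc : 0 < c := by positivity
  have hc1 : c ≤ 1 / (4 * m) := by
    refine mul_le_of_le_one_right (by positivity) (pow_le_one₀ (by positivity) ?_)
    rw [div_le_one (by positivity)]; linarith
  have hc2 : (1 : ℝ) / (4 * m) ≤ 1 := by rw [div_le_one (by positivity)]; linarith
  refine ⟨c / 22, by positivity, fun γ hγ hsupp h => ⟨?_, ?_⟩⟩
  · refine (wassersteinSq_uniformLaw_le (by positivity) hsupp h).trans
      (le_trans (ENNReal.ofReal_le_ofReal ?_) (le_median (le_wassersteinSq_empiricalCDF hm)))
    change _ ≤ c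
    nlinarith
  · refine (ksDist_le h).trans
      (le_trans (ENNReal.ofReal_le_ofReal ?_) (le_median (le_ksDist_empiricalCDF hm)))
    linarith

/-! ### The distribution function of a Gaussian law -/

lemma continuous_gaussianPDFReal (m : ℝ) (v : ℝ≥0) : Continuous (gaussianPDFReal m v) := by
  unfold gaussianPDFReal
  fun_prop

lemma hasDerivAt_cdf_gaussianReal (m : ℝ) {v : ℝ≥0} (hv : v ≠ 0) (x : ℝ) :
    HasDerivAt (cdf (gaussianReal m v)) (gaussianPDFReal m v x) x := by
  have hcdf : ∀ t, cdf (gaussianReal m v) t = ∫ s in Set.Iic t, gaussianPDFReal m v s := fun t => by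
    rw [cdf_eq_real, measureReal_def, gaussianReal_apply_eq_integral m hv,
      ENNReal.toReal_ofReal (integral_nonneg fun s => gaussianPDFReal_nonneg m v s)]
  have h : (cdf (gaussianReal m v) : ℝ → ℝ) =
      fun t => cdf (gaussianReal m v) 0 + ∫ s in (0 : ℝ)..t, gaussianPDFReal m v s := by
    ext t
    rw [hcdf, hcdf, ← intervalIntegral.integral_Iic_sub_Iic
      (integrable_gaussianPDFReal m v).integrableOn (integrable_gaussianPDFReal m v).integrableOn]
    ring
  rw [h]
  exact ((continuous_gaussianPDFReal m v).integral_hasStrictDerivAt 0 x).hasDerivAt.const_add _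

lemma continuous_cdf_gaussianReal (m : ℝ) {v : ℝ≥0} (hv : v ≠ 0) :
    Continuous (cdf (gaussianReal m v)) :=
  continuous_iff_continuousAt.2 fun x => (hasDerivAt_cdf_gaussianReal m hv x).continuousAt

lemma strictMono_cdf_gaussianReal (m : ℝ) {v : ℝ≥0} (hv : v ≠ 0) :
    StrictMono (cdf (gaussianReal m v)) :=
  strictMono_of_hasDerivAt_pos (hasDerivAt_cdf_gaussianReal m hv)
    fun x => gaussianPDFReal_pos m v x hv

lemma lipschitzWith_cdf_stdGaussian : LipschitzWith 1 (cdf (gaussianReal 0 1)) := by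
  refine lipschitzWith_of_nnnorm_deriv_le
    (fun x => (hasDerivAt_cdf_gaussianReal 0 one_ne_zero x).differentiableAt) fun x => ?_
  rw [(hasDerivAt_cdf_gaussianReal 0 one_ne_zero x).deriv, ← NNReal.coe_le_coe, coe_nnnorm,
    Real.norm_of_nonneg (gaussianPDFReal_nonneg _ _ _), gaussianPDFReal]
  refine mul_le_one₀ (inv_le_one_of_one_le₀ ?_) (Real.exp_nonneg _) (Real.exp_le_one_iff.2 ?_)
  · rw [Real.one_le_sqrt]
    simp only [NNReal.coe_one]
    linarith [Real.pi_gt_three]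
  · exact div_nonpos_of_nonpos_of_nonneg (neg_nonpos.2 (sq_nonneg _)) (by positivity)

/-! ### Transporting a law by matching distribution functions -/

lemma cdf_pos_of_strictMono {μ : Measure ℝ} (hμ : StrictMono (cdf μ)) (x : ℝ) : 0 < cdf μ x :=
  (cdf_nonneg μ (x - 1)).trans_lt (hμ (by linarith))

lemma cdf_lt_one_of_strictMono {μ : Measure ℝ} (hμ : StrictMono (cdf μ)) (x : ℝ) : cdf μ x < 1 :=
  (hμ (by linarith)).trans_le (cdf_le_one μ (x + 1))

lemma exists_cdf_eq {μ : Measure ℝ} (hμ : Continuous (cdf μ)) {p : ℝ} (hp : p ∈ Set.Ioo (0 : ℝ) 1) :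
    ∃ x, cdf μ x = p :=
  mem_range_of_exists_le_of_exists_ge hμ
    ((tendsto_cdf_atBot μ).eventually (eventually_le_nhds hp.1)).exists
    ((tendsto_cdf_atTop μ).eventually (eventually_ge_nhds hp.2)).exists

/-- If `T` matches the distribution function `F` of `μ` with that of `ν`, that is,
`T = F_ν⁻¹ ∘ F_μ`, then `T` transports `μ` to `ν`. -/
lemma map_eq_of_cdf_comp_eq {μ ν : Measure ℝ} [IsProbabilityMeasure μ] [IsProbabilityMeasure ν]
    (hμ : Continuous (cdf μ)) (hμ' : StrictMono (cdf μ)) (hν : StrictMono (cdf ν))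
    {T : ℝ → ℝ} (hT : ∀ x, cdf ν (T x) = cdf μ x) : Measurable T ∧ μ.map T = ν := by
  have hmono : Monotone T := fun x y hxy => hν.le_iff_le.1 (by rw [hT, hT]; exact hμ'.monotone hxy)
  refine ⟨hmono.measurable, ?_⟩
  have := Measure.isProbabilityMeasure_map (μ := μ) hmono.measurable.aemeasurable
  refine Measure.ext_of_Iic _ _ fun t => ?_
  obtain ⟨a, ha⟩ := exists_cdf_eq hμ ⟨cdf_pos_of_strictMono hν t, cdf_lt_one_of_strictMono hν t⟩
  have hset : T ⁻¹' Set.Iic t = Set.Iic a := by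
    ext x
    rw [Set.mem_preimage, Set.mem_Iic, ← hν.le_iff_le, hT, ← ha, hμ'.le_iff_le, Set.mem_Iic]
  rw [Measure.map_apply hmono.measurable measurableSet_Iic, hset, ← ofReal_cdf, ha, ofReal_cdf]

/-- The probability integral transform. -/
lemma map_cdf_eq_uniformLaw {μ : Measure ℝ} [IsProbabilityMeasure μ]
    (hμ : Continuous (cdf μ)) (hμ' : StrictMono (cdf μ)) :
    μ.map (cdf μ) = uniformLaw 0 1 := by
  have hm : Measurable (cdf μ) := hμ.measurable
  have := Measure.isProbabilityMeasure_map (μ := μ) hm.aemeasurable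
  have := isProbabilityMeasure_uniformLaw (zero_lt_one' ℝ)
  have hsupp : μ.map (cdf μ) (Set.Icc 0 1)ᶜ = 0 := by
    rw [Measure.map_apply hm measurableSet_Icc.compl]
    convert measure_empty (μ := μ)
    exact Set.eq_empty_of_forall_notMem fun x hx => hx ⟨cdf_nonneg μ x, cdf_le_one μ x⟩
  refine Measure.eq_of_cdf _ _ (StieltjesFunction.ext fun p => ?_)
  rcases lt_or_ge p 0 with hp | hp
  · rw [cdf_eq_zero_of_compl_Icc hsupp hp, cdf_eq_zero_of_compl_Icc (uniformLaw_compl_Icc 0 1) hp]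
  rcases le_or_gt 1 p with hp1 | hp1
  · rw [cdf_eq_one_of_compl_Icc hsupp hp1, cdf_eq_one_of_compl_Icc (uniformLaw_compl_Icc 0 1) hp1]
  rw [cdf_uniformLaw one_pos ⟨hp, hp1.le⟩, cdf_eq_real, measureReal_def,
    Measure.map_apply hm measurableSet_Iic, sub_zero, sub_zero, div_one]
  rcases hp.eq_or_lt with rfl | hp
  · have : cdf μ ⁻¹' Set.Iic 0 = ∅ := Set.eq_empty_of_forall_notMem fun x hx =>
      (cdf_pos_of_strictMono hμ' x).not_ge hx
    rw [this, measure_empty, ENNReal.toReal_zero]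
  · obtain ⟨a, rfl⟩ := exists_cdf_eq hμ ⟨hp, hp1⟩
    have : cdf μ ⁻¹' Set.Iic (cdf μ a) = Set.Iic a := by ext x; simp [hμ'.le_iff_le]
    rw [this, ← measureReal_def, cdf_eq_real]

/-! ### A standard Gaussian variable with a small uniform perturbation -/

/-- The joint law of independent `Z ∼ 𝒩(0,1)` and `U ∼ 𝒰[-1,1]`. -/
noncomputable def gaussianUniform : Measure (ℝ × ℝ) := (gaussianReal 0 1).prod (uniformLaw (-1) 1)

/-- The law of `Z + ε U` for independent `Z ∼ 𝒩(0,1)` and `U ∼ 𝒰[-1,1]`. -/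
noncomputable def perturbedGaussian (ε : ℝ) : Measure ℝ := gaussianUniform.map fun p => p.1 + ε * p.2

instance : IsProbabilityMeasure (uniformLaw (-1) 1) :=
  isProbabilityMeasure_uniformLaw (by norm_num)

instance : IsProbabilityMeasure gaussianUniform := by
  unfold gaussianUniform; infer_instance

instance (ε : ℝ) : IsProbabilityMeasure (perturbedGaussian ε) :=
  Measure.isProbabilityMeasure_map (by fun_prop)

lemma integrable_cdf_comp {α : Type*} [MeasurableSpace α] {P : Measure α} [IsFiniteMeasure P]
    (μ : Measure ℝ) {f : α → ℝ} (hf : Measurable f) : Integrable (fun u => cdf μ (f u)) P := by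
  refine Integrable.of_bound ((monotone_cdf μ).measurable.comp hf).aestronglyMeasurable 1
    (ae_of_all _ fun u => ?_)
  rw [Real.norm_of_nonneg (cdf_nonneg _ _)]
  exact cdf_le_one _ _

lemma cdf_perturbedGaussian (ε x : ℝ) :
    cdf (perturbedGaussian ε) x =
      ∫ u, cdf (gaussianReal 0 1) (x - ε * u) ∂uniformLaw (-1) 1 := by
  have hm : Measurable fun p : ℝ × ℝ => p.1 + ε * p.2 := by fun_prop
  rw [cdf_eq_real, measureReal_def, perturbedGaussian, Measure.map_apply hm measurableSet_Iic,
    gaussianUniform, Measure.prod_apply_symm (hm measurableSet_Iic),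
    integral_eq_lintegral_of_nonneg_ae (ae_of_all _ fun u => cdf_nonneg _ _)
      (integrable_cdf_comp _ (by fun_prop)).aestronglyMeasurable]
  congr 1
  refine lintegral_congr fun u => ?_
  rw [ofReal_cdf]
  congr 1
  ext z
  simp [le_sub_iff_add_le]

lemma continuous_cdf_perturbedGaussian (ε : ℝ) : Continuous (cdf (perturbedGaussian ε)) := by
  have h := continuous_cdf_gaussianReal 0 one_ne_zero
  rw [show (cdf (perturbedGaussian ε) : ℝ → ℝ) = _ from funext (cdf_perturbedGaussian ε)]
  refine continuous_of_dominated (bound := fun _ => 1)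
    (fun x => (integrable_cdf_comp _ (by fun_prop)).aestronglyMeasurable)
    (fun x => ae_of_all _ fun u => ?_) (integrable_const _) (ae_of_all _ fun u => by fun_prop)
  rw [Real.norm_of_nonneg (cdf_nonneg _ _)]
  exact cdf_le_one _ _

lemma strictMono_cdf_perturbedGaussian (ε : ℝ) : StrictMono (cdf (perturbedGaussian ε)) := by
  intro x y hxy
  rw [cdf_perturbedGaussian, cdf_perturbedGaussian, ← sub_pos,
    ← integral_sub (integrable_cdf_comp _ (by fun_prop)) (integrable_cdf_comp _ (by fun_prop))]
  have hpos : ∀ u, 0 < cdf (gaussianReal 0 1) (y - ε * u) - cdf (gaussianReal 0 1) (x - ε * u) :=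
    fun u => sub_pos.2 (strictMono_cdf_gaussianReal 0 one_ne_zero (by linarith))
  rw [integral_pos_iff_support_of_nonneg (fun u => (hpos u).le)
    ((integrable_cdf_comp _ (by fun_prop)).sub (integrable_cdf_comp _ (by fun_prop)))]
  simp [Function.support, (hpos _).ne']

lemma ae_mem_Icc_uniformLaw (a b : ℝ) : ∀ᵐ u ∂uniformLaw a b, u ∈ Set.Icc a b :=
  mem_ae_iff.2 (uniformLaw_compl_Icc a b)

lemma integrable_id_uniformLaw : Integrable (fun u : ℝ => u) (uniformLaw (-1) 1) := by
  refine Integrable.of_bound measurable_id.aestronglyMeasurable 1 ?_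
  filter_upwards [ae_mem_Icc_uniformLaw (-1) 1] with u hu
  exact abs_le.2 hu

lemma integral_id_uniformLaw : ∫ u, u ∂uniformLaw (-1) 1 = 0 := by
  rw [uniformLaw, ProbabilityTheory.cond, integral_smul_measure, integral_Icc_eq_integral_Ioc,
    ← intervalIntegral.integral_of_le (by norm_num), integral_id]
  norm_num

/-- Since `U` is centred, to first order in `ε` the perturbation `ε U` does not change the
distribution function of `Z`: the distribution function of `Z + ε U` at `z + ε u` is
`Φ(z) + ε u Φ'(z) + o(ε)`. -/
lemma hasDerivAt_cdf_perturbedGaussian (z u : ℝ) :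
    HasDerivAt (fun ε => cdf (perturbedGaussian ε) (z + ε * u)) (u * gaussianPDFReal 0 1 z) 0 := by
  have hrw : (fun ε => cdf (perturbedGaussian ε) (z + ε * u)) =
      fun ε => ∫ t, cdf (gaussianReal 0 1) (z + ε * (u - t)) ∂uniformLaw (-1) 1 := by
    ext ε
    rw [cdf_perturbedGaussian]
    congr! 3
    ring
  have hint : ∫ t, gaussianPDFReal 0 1 z * (u - t) ∂uniformLaw (-1) 1 =
      u * gaussianPDFReal 0 1 z := by
    rw [integral_const_mul, integral_sub (integrable_const _) integrable_id_uniformLaw,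
      integral_id_uniformLaw]
    simp [mul_comm]
  rw [hrw, ← hint]
  refine (hasDerivAt_integral_of_dominated_loc_of_lip (s := Set.univ) (bound := fun t => |u - t|)
    univ_mem (Eventually.of_forall fun ε =>
      (integrable_cdf_comp _ (by fun_prop)).aestronglyMeasurable)
    (integrable_cdf_comp _ (by fun_prop)) (by fun_prop) (ae_of_all _ fun t => ?_)
    ((integrable_const _).sub integrable_id_uniformLaw).abs (ae_of_all _ fun t => ?_)).2
  · refine LipschitzWith.lipschitzOnWith (LipschitzWith.of_dist_le_mul fun x y => ?_)
    refine (lipschitzWith_cdf_stdGaussian.dist_le_mul _ _).trans_eq ?_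
    simp [Real.dist_eq, ← sub_mul, abs_mul, mul_comm]
  · have h1 : HasDerivAt (fun ε : ℝ => z + ε * (u - t)) (u - t) 0 := by
      simpa using ((hasDerivAt_id (0 : ℝ)).mul_const (u - t)).const_add z
    have h2 : HasDerivAt (cdf (gaussianReal 0 1)) (gaussianPDFReal 0 1 z)
        (z + 0 * (u - t)) := by simpa using hasDerivAt_cdf_gaussianReal 0 one_ne_zero z
    exact h2.comp 0 h1

/-- A function that vanishes at `0` and has positive derivative there is positive just to the right
of `0`. -/
lemma eventually_pos_of_hasDerivAt {f : ℝ → ℝ} {f' : ℝ} (hf : HasDerivAt f f' 0) (h0 : f 0 = 0)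
    (hf' : 0 < f') : ∀ᶠ ε in 𝓝[>] (0 : ℝ), 0 < f ε := by
  have h := (hasDerivAt_iff_tendsto_slope.1 hf).eventually (eventually_gt_nhds hf')
  have h' : ∀ᶠ ε in 𝓝[>] (0 : ℝ), 0 < slope f 0 ε :=
    h.filter_mono (nhdsWithin_mono _ fun x (hx : 0 < x) => hx.ne')
  filter_upwards [h', self_mem_nhdsWithin] with ε h1 (h2 : 0 < ε)
  rw [slope_def_field, h0, sub_zero, sub_zero] at h1
  exact (div_pos_iff_of_pos_right h2).1 h1

/-- If `T ε` transports the law of `Z + ε U` to that of `Z`, then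
`(T ε (Z + ε U) - Z) / ε → U` pointwise as `ε ↓ 0`. -/
lemma tendsto_transport_sub_div {T : ℝ → ℝ → ℝ}
    (hT : ∀ ε x, cdf (gaussianReal 0 1) (T ε x) = cdf (perturbedGaussian ε) x) (z u : ℝ) :
    Tendsto (fun ε => (T ε (z + ε * u) - z) / ε) (𝓝[>] 0) (𝓝 u) := by
  have hmono := strictMono_cdf_gaussianReal 0 (one_ne_zero (α := ℝ≥0))
  have hφ := gaussianPDFReal_pos 0 1 z one_ne_zero
  have hG := hasDerivAt_cdf_perturbedGaussian z u
  have hG0 : cdf (perturbedGaussian 0) (z + 0 * u) = cdf (gaussianReal 0 1) z := by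
    rw [cdf_perturbedGaussian]; simp
  have hΦ : ∀ a, HasDerivAt (fun ε : ℝ => cdf (gaussianReal 0 1) (z + ε * a))
      (a * gaussianPDFReal 0 1 z) 0 := fun a => by
    have h1 : HasDerivAt (fun ε : ℝ => z + ε * a) a 0 := by
      simpa using ((hasDerivAt_id (0 : ℝ)).mul_const a).const_add z
    have h2 : HasDerivAt (cdf (gaussianReal 0 1)) (gaussianPDFReal 0 1 z) (z + 0 * a) := by
      simpa using hasDerivAt_cdf_gaussianReal 0 one_ne_zero z
    rw [mul_comm]
    exact h2.comp 0 h1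
  refine tendsto_order.2 ⟨fun a ha => ?_, fun a ha => ?_⟩
  · filter_upwards [self_mem_nhdsWithin, eventually_pos_of_hasDerivAt (hG.sub (hΦ a))
      (by simp only [Pi.sub_apply, hG0]; simp) (by nlinarith)] with ε (hε : 0 < ε) h
    rw [Pi.sub_apply, sub_pos, ← hT, hmono.lt_iff_lt] at h
    rw [lt_div_iff₀ hε]
    linarith
  · filter_upwards [self_mem_nhdsWithin, eventually_pos_of_hasDerivAt ((hΦ a).sub hG)
      (by simp only [Pi.sub_apply, hG0]; simp) (by nlinarith)] with ε (hε : 0 < ε) h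
    rw [Pi.sub_apply, sub_pos, ← hT, hmono.lt_iff_lt] at h
    rw [div_lt_iff₀ hε]
    linarith

lemma transport_sub_div_mem_Icc {T : ℝ → ℝ} {ε : ℝ} (hε : 0 < ε)
    (hT : ∀ x, cdf (gaussianReal 0 1) (T x) = cdf (perturbedGaussian ε) x) (z : ℝ) {u : ℝ}
    (hu : u ∈ Set.Icc (-1 : ℝ) 1) : (T (z + ε * u) - z) / ε ∈ Set.Icc (-2 : ℝ) 2 := by
  have hmono := strictMono_cdf_gaussianReal 0 (one_ne_zero (α := ℝ≥0))
  have hT' := hT (z + ε * u)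
  rw [cdf_perturbedGaussian] at hT'
  have hi := integrable_cdf_comp (P := uniformLaw (-1) 1) (gaussianReal 0 1)
    (f := fun t => z + ε * u - ε * t) (by fun_prop)
  have hle : T (z + ε * u) ≤ z + ε * 2 := by
    rw [← hmono.le_iff_le, hT']
    refine (integral_mono_ae hi (integrable_const (cdf (gaussianReal 0 1) (z + ε * 2))) ?_).trans_eq
      (by simp)
    filter_upwards [ae_mem_Icc_uniformLaw (-1) 1] with t ht
    exact monotone_cdf _ (by nlinarith [hu.2, ht.1])
  have hge : z - ε * 2 ≤ T (z + ε * u) := by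
    rw [← hmono.le_iff_le, hT']
    refine Eq.trans_le (by simp)
      (integral_mono_ae (integrable_const (cdf (gaussianReal 0 1) (z - ε * 2))) hi ?_)
    filter_upwards [ae_mem_Icc_uniformLaw (-1) 1] with t ht
    exact monotone_cdf _ (by nlinarith [hu.1, ht.2])
  constructor
  · rw [le_div_iff₀ hε]; linarith
  · rw [div_le_iff₀ hε]; linarith

/-! ### Two Gaussian variables whose difference is almost uniform -/

/-- If `U ∼ 𝒰[-1,1]` and `|S - U| < η` off an event of probability at most `p`, then the
distribution functions of `S` and `U` differ by at most `η / 2 + p`. -/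
lemma abs_cdf_map_sub_cdf_uniformLaw_le {Ω : Type*} [MeasurableSpace Ω] {P : Measure Ω}
    [IsProbabilityMeasure P] {S U : Ω → ℝ} (hS : Measurable S) (hU : Measurable U)
    (hlaw : P.map U = uniformLaw (-1) 1) {η p : ℝ} (hη : 0 ≤ η)
    (h : P.real {ω | η ≤ dist (S ω) (U ω)} ≤ p) (x : ℝ) :
    |cdf (P.map S) x - cdf (uniformLaw (-1) 1) x| ≤ η / 2 + p := by
  have := Measure.isProbabilityMeasure_map (μ := P) hS.aemeasurable
  have hcS : cdf (P.map S) x = P.real {ω | S ω ≤ x} := by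
    rw [cdf_eq_real, map_measureReal_apply hS measurableSet_Iic]; rfl
  have hcU : ∀ y, cdf (uniformLaw (-1) 1) y = P.real {ω | U ω ≤ y} := fun y => by
    rw [cdf_eq_real, ← hlaw, map_measureReal_apply hU measurableSet_Iic]; rfl
  have h1 : P.real {ω | S ω ≤ x} ≤ P.real {ω | U ω ≤ x + η} + p := by
    have hsub : {ω | S ω ≤ x} ⊆ {ω | U ω ≤ x + η} ∪ {ω | η ≤ dist (S ω) (U ω)} := by
      intro ω (hω : S ω ≤ x)
      by_contra hc
      have hc1 : ¬ U ω ≤ x + η := fun h => hc (Or.inl h)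
      have hc2 : ¬ η ≤ |S ω - U ω| := fun h => hc (Or.inr h)
      rw [not_le, abs_lt] at hc2
      linarith [hc2.1, hc2.2]
    exact (measureReal_mono hsub).trans ((measureReal_union_le _ _).trans (by gcongr))
  have h2 : P.real {ω | U ω ≤ x - η} ≤ P.real {ω | S ω ≤ x} + p := by
    have hsub : {ω | U ω ≤ x - η} ⊆ {ω | S ω ≤ x} ∪ {ω | η ≤ dist (S ω) (U ω)} := by
      intro ω (hω : U ω ≤ x - η)
      by_contra hc
      have hc1 : ¬ S ω ≤ x := fun h => hc (Or.inl h)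
      have hc2 : ¬ η ≤ |S ω - U ω| := fun h => hc (Or.inr h)
      rw [not_le, abs_lt] at hc2
      linarith [hc2.1, hc2.2]
    exact (measureReal_mono hsub).trans ((measureReal_union_le _ _).trans (by gcongr))
  rw [← hcS, ← hcU] at h1 h2
  have h3 := cdf_uniformLaw_add_le x hη
  have h4 := cdf_uniformLaw_add_le (x - η) hη
  rw [sub_add_cancel] at h4
  rw [abs_le]
  constructor <;> linarith

/-- For a suitable variance, two centred Gaussian variables with that variance can be coupled so
that their difference is bounded by `2` and is `δ`-close to `𝒰[-1,1]`. -/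
lemma exists_gaussian_coupling {δ : ℝ} (hδ : 0 < δ) :
    ∃ v : ℝ≥0, 0 < v ∧ ∃ κ : Measure (ℝ × ℝ), IsProbabilityMeasure κ ∧
      κ.map Prod.fst = gaussianReal 0 v ∧ κ.map Prod.snd = gaussianReal 0 v ∧
      κ.map (fun p => p.2 - p.1) (Set.Icc (-2) 2)ᶜ = 0 ∧
      ∀ x, |cdf (κ.map fun p => p.2 - p.1) x - cdf (uniformLaw (-1) 1) x| ≤ δ := by
  have hmono := strictMono_cdf_gaussianReal 0 (one_ne_zero (α := ℝ≥0))
  have hex : ∀ ε x, ∃ y, cdf (gaussianReal 0 1) y = cdf (perturbedGaussian ε) x := fun ε x =>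
    exists_cdf_eq (continuous_cdf_gaussianReal 0 one_ne_zero)
      ⟨cdf_pos_of_strictMono (strictMono_cdf_perturbedGaussian ε) x,
        cdf_lt_one_of_strictMono (strictMono_cdf_perturbedGaussian ε) x⟩
  choose T hT using hex
  have hTmap := fun ε => map_eq_of_cdf_comp_eq (continuous_cdf_perturbedGaussian ε)
    (strictMono_cdf_perturbedGaussian ε) hmono (hT ε)
  have hTm : ∀ ε, Measurable (T ε) := fun ε => (hTmap ε).1
  set S : ℝ → ℝ × ℝ → ℝ := fun ε p => (T ε (p.1 + ε * p.2) - p.1) / ε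
  have hXm : ∀ ε, Measurable fun p : ℝ × ℝ => T ε (p.1 + ε * p.2) := fun ε =>
    (hTm ε).comp (by fun_prop)
  have hSm : ∀ ε, Measurable (S ε) := fun ε => ((hXm ε).sub measurable_fst).div_const _
  have hpos : ∀ k : ℕ, (0 : ℝ) < 1 / ((k : ℝ) + 1) := fun k => Nat.one_div_pos_of_nat
  have hlim : TendstoInMeasure gaussianUniform (fun (k : ℕ) => S (1 / ((k : ℝ) + 1))) atTop
      Prod.snd := by
    refine tendstoInMeasure_of_tendsto_ae (fun k => (hSm _).aestronglyMeasurable)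
      (ae_of_all _ fun p => ?_)
    refine (tendsto_transport_sub_div hT p.1 p.2).comp (tendsto_nhdsWithin_iff.2
      ⟨tendsto_one_div_add_atTop_nhds_zero_nat, Eventually.of_forall hpos⟩)
  obtain ⟨k, hk⟩ := ((tendstoInMeasure_iff_measureReal_dist.1 hlim δ hδ).eventually
    (eventually_le_nhds (half_pos hδ))).exists
  generalize hε : 1 / ((k : ℝ) + 1) = ε at hk
  have hε0 : 0 < ε := hε ▸ hpos k
  have hfst : gaussianUniform.map Prod.fst = gaussianReal 0 1 := by
    rw [gaussianUniform, ← Measure.fst, Measure.fst_prod]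
  have hsnd : gaussianUniform.map Prod.snd = uniformLaw (-1) 1 := by
    rw [gaussianUniform, ← Measure.snd, Measure.snd_prod]
  have hX : gaussianUniform.map (fun p => T ε (p.1 + ε * p.2)) = gaussianReal 0 1 := by
    rw [← (hTmap ε).2, perturbedGaussian, Measure.map_map (hTm ε) (by fun_prop)]
    rfl
  -- Both variables are divided by `ε`, which turns `ε U` into `U` and the variance into `ε⁻²`.
  have hscale : ∀ f : ℝ × ℝ → ℝ, Measurable f → gaussianUniform.map f = gaussianReal 0 1 →
      gaussianUniform.map (fun p => ε⁻¹ * f p) =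
        gaussianReal 0 (.mk (ε⁻¹ ^ 2) (sq_nonneg _)) := by
    intro f hf hf'
    have := gaussianReal_map_const_mul (μ := 0) (v := 1) ε⁻¹
    rw [← hf', Measure.map_map (by fun_prop) hf, mul_zero, mul_one] at this
    exact this
  have hW : Measurable fun p : ℝ × ℝ => (ε⁻¹ * p.1, ε⁻¹ * T ε (p.1 + ε * p.2)) :=
    (measurable_fst.const_mul _).prodMk ((hXm ε).const_mul _)
  have hdiff : (gaussianUniform.map fun p : ℝ × ℝ => (ε⁻¹ * p.1, ε⁻¹ * T ε (p.1 + ε * p.2))).map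
      (fun p => p.2 - p.1) = gaussianUniform.map (S ε) := by
    rw [Measure.map_map (by fun_prop) hW]
    congr 1
    ext p
    simp only [Function.comp_apply, S]
    ring
  refine ⟨.mk (ε⁻¹ ^ 2) (sq_nonneg _), ?_, gaussianUniform.map _,
    Measure.isProbabilityMeasure_map hW.aemeasurable, ?_, ?_, ?_, ?_⟩
  · exact NNReal.coe_pos.1 (show (0 : ℝ) < ε⁻¹ ^ 2 by positivity)
  · rw [Measure.map_map measurable_fst hW]
    exact hscale _ measurable_fst hfst
  · rw [Measure.map_map measurable_snd hW]
    exact hscale _ (hXm ε) hX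
  · rw [hdiff, Measure.map_apply (hSm ε) measurableSet_Icc.compl]
    refine measure_mono_null (t := Prod.snd ⁻¹' (Set.Icc (-1 : ℝ) 1)ᶜ) ?_ ?_
    · intro p hp hp'
      exact hp (transport_sub_div_mem_Icc hε0 (hT ε) p.1 hp')
    · rw [← Measure.map_apply measurable_snd measurableSet_Icc.compl, hsnd, uniformLaw_compl_Icc]
  · intro x
    rw [hdiff]
    refine (abs_cdf_map_sub_cdf_uniformLaw_le (hSm ε) measurable_snd hsnd hδ.le hk x).trans ?_
    linarith

/-! ### Gaussian vectors with a prescribed sum -/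

/-- If `A` and `B` are independent with law `𝒩(0, v)` and `a² + b² = 1`, then `a A + b B` has law
`𝒩(0, v)` as well. -/
lemma map_linearCombination_gaussianReal {Ω : Type*} [MeasurableSpace Ω] {P : Measure Ω}
    {A B : Ω → ℝ} {v : ℝ≥0} (hA : Measurable A) (hB : Measurable B)
    (hAB : IndepFun A B P) (hA' : P.map A = gaussianReal 0 v) (hB' : P.map B = gaussianReal 0 v)
    {a b : ℝ} (hab : a ^ 2 + b ^ 2 = 1) :
    P.map (fun ω => a * A ω + b * B ω) = gaussianReal 0 v := by
  have hc : ∀ (c : ℝ) (f : Ω → ℝ), Measurable f → P.map f = gaussianReal 0 v →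
      P.map (fun ω => c * f ω) = gaussianReal 0 (.mk (c ^ 2) (sq_nonneg _) * v) := by
    intro c f hf h
    have := gaussianReal_map_const_mul (μ := 0) (v := v) c
    rw [← h, Measure.map_map (by fun_prop) hf, mul_zero] at this
    exact this
  have h := gaussianReal_add_gaussianReal_of_indepFun
    (hAB.comp (φ := fun x => a * x) (ψ := fun x => b * x) (by fun_prop) (by fun_prop))
    (hc a A hA hA') (hc b B hB hB')
  rw [zero_add, ← add_mul] at h
  have h1 : (NNReal.mk (a ^ 2) (sq_nonneg _) + NNReal.mk (b ^ 2) (sq_nonneg _)) = 1 :=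
    NNReal.eq hab
  rw [h1, one_mul] at h
  exact h

/-- A coupling `κ` of two `𝒩(0, v)` variables `Z` and `X` extends to `k + 2` variables with law
`𝒩(0, v)` whose sum is `X - Z`. With `Y ∼ 𝒩(0, v)` independent of `(Z, X)` one takes `-Z, X` for
two variables, `X, (-Z + √3 Y) / 2, (-Z - √3 Y) / 2` for three, and adjoins pairs `Y, -Y`. -/
lemma exists_gaussian_vector_sum_eq {v : ℝ≥0} (κ : Measure (ℝ × ℝ)) [IsProbabilityMeasure κ]
    (h1 : κ.map Prod.fst = gaussianReal 0 v) (h2 : κ.map Prod.snd = gaussianReal 0 v) (k : ℕ) :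
    ∃ f : (ℝ × ℝ) × ℝ → Fin (k + 2) → ℝ, Measurable f ∧
      (∀ i, (κ.prod (gaussianReal 0 v)).map (fun ω => f ω i) = gaussianReal 0 v) ∧
      ∀ ω, ∑ i, f ω i = ω.1.2 - ω.1.1 := by
  have hfst : (κ.prod (gaussianReal 0 v)).map Prod.fst = κ := by
    rw [← Measure.fst, Measure.fst_prod]
  have hZ : (κ.prod (gaussianReal 0 v)).map (fun ω => ω.1.1) = gaussianReal 0 v :=
    (Measure.map_map measurable_fst measurable_fst).symm.trans ((congrArg _ hfst).trans h1)
  have hX : (κ.prod (gaussianReal 0 v)).map (fun ω => ω.1.2) = gaussianReal 0 v :=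
    (Measure.map_map measurable_snd measurable_fst).symm.trans ((congrArg _ hfst).trans h2)
  have hY : (κ.prod (gaussianReal 0 v)).map (fun ω => ω.2) = gaussianReal 0 v := by
    change (κ.prod (gaussianReal 0 v)).snd = _
    rw [Measure.snd_prod]
  have hneg : ∀ f : (ℝ × ℝ) × ℝ → ℝ, Measurable f →
      (κ.prod (gaussianReal 0 v)).map f = gaussianReal 0 v →
      (κ.prod (gaussianReal 0 v)).map (fun ω => - f ω) = gaussianReal 0 v := by
    intro f hf h
    have := gaussianReal_map_neg (μ := 0) (v := v)
    rw [neg_zero] at this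
    exact (Measure.map_map measurable_neg hf).symm.trans ((congrArg _ h).trans this)
  have hind : IndepFun (fun ω : (ℝ × ℝ) × ℝ => ω.1.1) (fun ω => ω.2)
      (κ.prod (gaussianReal 0 v)) :=
    indepFun_prod measurable_fst measurable_id
  induction k using Nat.twoStepInduction with
  | zero =>
    refine ⟨fun ω => ![-ω.1.1, ω.1.2], measurable_pi_iff.2 fun i => ?_, fun i => ?_, fun ω => ?_⟩
    · fin_cases i <;> simp <;> fun_prop
    · fin_cases i
      · exact hneg _ (by fun_prop) hZ
      · exact hX
    · rw [Fin.sum_univ_two]; simp; ring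
  | one =>
    have h3 : (√3 : ℝ) ^ 2 = 3 := Real.sq_sqrt (by norm_num)
    refine ⟨fun ω => ![ω.1.2, (-1 / 2) * ω.1.1 + (√3 / 2) * ω.2,
      (-1 / 2) * ω.1.1 + (-√3 / 2) * ω.2], measurable_pi_iff.2 fun i => ?_, fun i => ?_,
      fun ω => ?_⟩
    · fin_cases i <;> simp <;> fun_prop
    · fin_cases i
      · exact hX
      · exact map_linearCombination_gaussianReal (by fun_prop) (by fun_prop) hind hZ hY
          (by linear_combination h3 / 4)
      · exact map_linearCombination_gaussianReal (by fun_prop) (by fun_prop) hind hZ hY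
          (by linear_combination h3 / 4)
    · rw [Fin.sum_univ_three]; simp; ring
  | more k ih _ =>
    obtain ⟨f, hf, hfi, hsum⟩ := ih
    refine ⟨fun ω => Fin.cons ω.2 (Fin.cons (-ω.2) (f ω)), measurable_pi_iff.2 fun i => ?_,
      fun i => ?_, fun ω => ?_⟩
    · induction i using Fin.cases with
      | zero => exact measurable_snd
      | succ i =>
        induction i using Fin.cases with
        | zero => exact measurable_snd.neg
        | succ i => exact (measurable_pi_apply i).comp hf
    · induction i using Fin.cases with
      | zero => exact hY
      | succ i =>
        induction i using Fin.cases with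
        | zero => exact hneg _ measurable_snd hY
        | succ i => exact hfi i
    · rw [Fin.sum_univ_succ, Fin.sum_univ_succ]
      simp [hsum]

/-! ### Copulas and joint laws -/

/-- The easy half of Sklar's theorem: for a continuous and strictly increasing marginal
distribution function `F`, the joint distribution function of `F(X₁), …, F(Xₙ)` is a copula
of `X₁, …, Xₙ`. -/
lemma exists_isCopula_isJointLaw {n : ℕ} {ρ : Measure ℝ} [IsProbabilityMeasure ρ]
    (hρ : Continuous (cdf ρ)) (hρ' : StrictMono (cdf ρ)) (μ : Measure (Fin n → ℝ))
    [IsProbabilityMeasure μ] (hμ : ∀ i, μ.map (fun x => x i) = ρ) :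
    ∃ C : (Fin n → ℝ) → ℝ, IsCopula C ∧ IsJointLaw μ ρ C := by
  have hm : Measurable fun (x : Fin n → ℝ) i => cdf ρ (x i) :=
    measurable_pi_iff.2 fun i => hρ.measurable.comp (measurable_pi_apply i)
  have hbox : ∀ u : Fin n → ℝ, MeasurableSet {x : Fin n → ℝ | ∀ i, x i ≤ u i} := fun u =>
    measurableSet_Iic (a := u)
  refine ⟨fun u => (μ.map fun x i => cdf ρ (x i)).real {x | ∀ i, x i ≤ u i},
    ⟨_, Measure.isProbabilityMeasure_map hm.aemeasurable, fun i => ?_, fun u _ => rfl⟩,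
    inferInstance, hμ, fun x => ?_⟩
  · rw [Measure.map_map (measurable_pi_apply i) hm]
    exact (Measure.map_map hρ.measurable (measurable_pi_apply i)).symm.trans
      ((congrArg _ (hμ i)).trans (map_cdf_eq_uniformLaw hρ hρ'))
  · rw [map_measureReal_apply hm (hbox _)]
    congr 1
    ext y
    exact forall_congr' fun i => hρ'.le_iff_le.symm

/-- Probability measures on `ℝⁿ` with the same joint distribution function are equal. -/
lemma ext_of_measure_pi_Iic {n : ℕ} {μ ν : Measure (Fin n → ℝ)} [IsProbabilityMeasure μ]
    [IsProbabilityMeasure ν] (h : ∀ x : Fin n → ℝ, μ (Set.Iic x) = ν (Set.Iic x)) : μ = ν := by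
  refine ext_of_generate_finite (Set.pi Set.univ '' Set.pi Set.univ fun _ => Set.range Set.Iic)
    (generateFrom_eq_pi (fun _ => ?_) fun _ => ?_).symm
    (IsPiSystem.pi fun _ => isPiSystem_Iic) ?_ (by simp)
  · rw [← borel_eq_generateFrom_Iic, BorelSpace.measurable_eq (α := ℝ)]
  · refine ⟨fun k : ℕ => Set.Iic (k : ℝ), fun k => ⟨_, rfl⟩, Set.eq_univ_of_forall fun x => ?_⟩
    exact Set.mem_iUnion.2 (exists_nat_ge x)
  · rintro _ ⟨s, hs, rfl⟩
    choose x hx using fun i => hs i (Set.mem_univ i)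
    have : Set.pi Set.univ s = Set.Iic x := by
      rw [← Set.pi_univ_Iic]
      exact congrArg _ (funext fun i => (hx i).symm)
    rw [this, h x]

/-- The marginals and the copula determine the joint law. -/
lemma IsJointLaw.unique {n : ℕ} {μ ν : Measure (Fin n → ℝ)} {ρ : Measure ℝ}
    {C : (Fin n → ℝ) → ℝ} (hμ : IsJointLaw μ ρ C) (hν : IsJointLaw ν ρ C) : μ = ν := by
  have := hμ.isProbabilityMeasure
  have := hν.isProbabilityMeasure
  refine ext_of_measure_pi_Iic fun x => ?_
  have h := (hμ.copula x).trans (hν.copula x).symm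
  exact (measureReal_eq_measureReal_iff).1 h

/-! ### Sums of Gaussian variables that are almost uniform -/

/-- For each `n ≥ 2` there are a copula `C` and a variance `v > 0` such that random variables
`X₁, …, Xₙ` which are `N(0, v)` with copula `C` exist, and the sum of any such random variables is
empirically indistinguishable from the uniform law on `[-1, 1]`. -/
theorem mainTheorem4 (n : ℕ) (hn : 2 ≤ n) :
    ∃ C : (Fin n → ℝ) → ℝ, IsCopula C ∧ ∃ v : ℝ≥0, 0 < v ∧
      (∃ μ : Measure (Fin n → ℝ), IsJointLaw μ (gaussianReal 0 v) C) ∧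
      ∀ μ : Measure (Fin n → ℝ), IsJointLaw μ (gaussianReal 0 v) C →
        EmpiricallyIndistinguishable (μ.map fun x => ∑ i, x i) (uniformLaw (-1) 1) := by
  obtain ⟨k, rfl⟩ := Nat.exists_eq_add_of_le' hn
  obtain ⟨δ, hδ, hclose⟩ := exists_forall_empiricallyIndistinguishable
  obtain ⟨v, hv, κ, hκ, h1, h2, hsupp, hcdf⟩ := exists_gaussian_coupling hδ
  obtain ⟨f, hf, hfi, hsum⟩ := exists_gaussian_vector_sum_eq κ h1 h2 k
  have := Measure.isProbabilityMeasure_map (μ := κ.prod (gaussianReal 0 v)) hf.aemeasurable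
  obtain ⟨C, hC, hμ⟩ := exists_isCopula_isJointLaw (continuous_cdf_gaussianReal 0 hv.ne')
    (strictMono_cdf_gaussianReal 0 hv.ne') ((κ.prod (gaussianReal 0 v)).map f) fun i => by
      rw [Measure.map_map (measurable_pi_apply i) hf]; exact hfi i
  refine ⟨C, hC, v, hv, ⟨_, hμ⟩, fun μ hμ' => ?_⟩
  have hlaw : (((κ.prod (gaussianReal 0 v)).map f).map fun x => ∑ i, x i) =
      κ.map fun p => p.2 - p.1 := by
    rw [Measure.map_map (by fun_prop) hf]
    conv_rhs => rw [← Measure.fst_prod (μ := κ) (ν := gaussianReal 0 v), Measure.fst,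
      Measure.map_map (by fun_prop) measurable_fst]
    exact congrArg (fun g => (κ.prod (gaussianReal 0 v)).map g) (funext hsum)
  rw [hμ'.unique hμ, hlaw]
  exact hclose _ (Measure.isProbabilityMeasure_map (by fun_prop)) hsupp hcdf
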